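/- Let $\mathbb{O}$ be the real algebra of octonions. A regular octonionic polynomial of degree $n$ is a function $f(w)=\sum_{i=0}^n w^i a_i$ on $\mathbb{O}$ with $a_i\in\mathbb{O}$ and $a_n\neq 0$; a zero of $f$ is an octonion at which it vanishes. For polynomials $f(w)=\sum_i w^i a_i$ and $g(w)=\sum_j w^j b_j$ put $$(f\ast g)(w)=\sum_k w^k\Big(\sum_{i+j=k}a_i b_j\Big).$$ Two octonions $\alpha,\beta$ are conjugate if $\beta=x\alpha x^{-1}$ for some nonzero $x\in\mathbb{O}$; equivalently, if they have the same real part and the same norm. **Factorization lemma.** Let $f$ be a regular octonionic polynomial of degree $n>0$ and let $\alpha_1$ be a zero of $f$. Then there exist $\alpha_2,\dots,\alpha_n,c\in\mathbb{O}$ with $c\neq 0$ and, writing $f_0=f$, regular octonionic polynomials $f_1,\dots,f_{n-1}$ such that $$f_k(w)=(w-\alpha_{k+1})\ast f_{k+1}(w)\quad\text{for } k=0,1,\dots,n-2,\qquad f_{n-1}(w)=(w-\alpha_n)\ast c .$$ That is, $$f(w)=(w-\alpha_1)\ast\big((w-\alpha_2)\ast(\cdots((w-\alpha_n)\ast c)\cdots)\big).$$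 Moreover, for every $k=1,\dots,n-1$, the octonion $\alpha_{k+1}$ is a zero of $f_k$ and is conjugate to some zero $\alpha'_{k+1}$ of $f$. -/

import Mathlib

open scoped Quaternion

/-- The real algebra `𝕆` of octonions, obtained from the quaternions by the Cayley-Dickson process:
`⟨x₁, x₂⟩` stands for `x₁ + x₂ k`. -/
@[ext]
structure Octonion where
  fst : ℍ[ℝ]
  snd : ℍ[ℝ]

namespace Octonion

noncomputable instance : Zero Octonion := ⟨⟨0, 0⟩⟩
noncomputable instance : One Octonion := ⟨⟨1, 0⟩⟩
noncomputable instance : Add Octonion := ⟨fun x y => ⟨x.fst + y.fst, x.snd + y.snd⟩⟩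
noncomputable instance : Neg Octonion := ⟨fun x => ⟨-x.fst, -x.snd⟩⟩
noncomputable instance : Sub Octonion := ⟨fun x y => ⟨x.fst - y.fst, x.snd - y.snd⟩⟩

noncomputable instance : SMul ℝ Octonion := ⟨fun r x => ⟨r • x.fst, r • x.snd⟩⟩

/-- `(x₁ + x₂ k)(y₁ + y₂ k) = x₁ y₁ - ȳ₂ x₂ + (x₂ ȳ₁ + y₂ x₁) k`. -/
noncomputable instance : Mul Octonion :=
  ⟨fun x y => ⟨x.fst * y.fst - star y.snd * x.snd, x.snd * star y.fst + y.snd * x.fst⟩⟩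

@[simp] theorem zero_fst : (0 : Octonion).fst = 0 := rfl
@[simp] theorem zero_snd : (0 : Octonion).snd = 0 := rfl
@[simp] theorem one_fst : (1 : Octonion).fst = 1 := rfl
@[simp] theorem one_snd : (1 : Octonion).snd = 0 := rfl
@[simp] theorem add_fst (x y : Octonion) : (x + y).fst = x.fst + y.fst := rfl
@[simp] theorem add_snd (x y : Octonion) : (x + y).snd = x.snd + y.snd := rfl
@[simp] theorem neg_fst (x : Octonion) : (-x).fst = -x.fst := rfl
@[simp] theorem neg_snd (x : Octonion) : (-x).snd = -x.snd := rfl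
@[simp] theorem sub_fst (x y : Octonion) : (x - y).fst = x.fst - y.fst := rfl
@[simp] theorem sub_snd (x y : Octonion) : (x - y).snd = x.snd - y.snd := rfl
@[simp] theorem smul_fst (r : ℝ) (x : Octonion) : (r • x).fst = r • x.fst := rfl
@[simp] theorem smul_snd (r : ℝ) (x : Octonion) : (r • x).snd = r • x.snd := rfl
@[simp] theorem mul_fst (x y : Octonion) :
    (x * y).fst = x.fst * y.fst - star y.snd * x.snd := rfl
@[simp] theorem mul_snd (x y : Octonion) :
    (x * y).snd = x.snd * star y.fst + y.snd * x.fst := rfl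

noncomputable instance : AddCommGroup Octonion where
  add_assoc x y z := by ext1 <;> simp [add_assoc]
  zero_add x := by ext1 <;> simp
  add_zero x := by ext1 <;> simp
  add_comm x y := by ext1 <;> simp [add_comm]
  neg_add_cancel x := by ext1 <;> simp
  sub_eq_add_neg x y := by ext1 <;> simp [sub_eq_add_neg]
  nsmul := nsmulRec
  zsmul := zsmulRec

noncomputable instance : NonAssocRing Octonion where
  left_distrib x y z := by ext1 <;> simp [mul_add, add_mul] <;> abel
  right_distrib x y z := by ext1 <;> simp [mul_add, add_mul] <;> abel
  zero_mul x := by ext1 <;> simp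
  mul_zero x := by ext1 <;> simp
  one_mul x := by ext1 <;> simp
  mul_one x := by ext1 <;> simp

noncomputable instance : Module ℝ Octonion where
  one_smul x := by ext1 <;> simp
  mul_smul r s x := by ext1 <;> simp [mul_smul]
  smul_zero r := by ext1 <;> simp
  smul_add r x y := by ext1 <;> simp
  add_smul r s x := by ext1 <;> simp [add_smul]
  zero_smul x := by ext1 <;> simp

/-- Powers `x ^ 0 = 1`, `x ^ (n + 1) = x ^ n * x`; octonions are power-associative, so the
bracketing is immaterial. -/
noncomputable instance : Pow Octonion ℕ := ⟨fun x n => npowRec n x⟩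

/-- Conjugation `x₁ + x₂ k ↦ x̄₁ - x₂ k`. -/
noncomputable instance : Star Octonion := ⟨fun x => ⟨star x.fst, -x.snd⟩⟩

/-- The squared norm `n_x`, the sum of the squares of the eight real coordinates of `x`. -/
noncomputable def normSq (x : Octonion) : ℝ :=
  Quaternion.normSq x.fst + Quaternion.normSq x.snd

/-- The inverse `x⁻¹ = n_x⁻¹ x̄` (with `0⁻¹ = 0`). -/
noncomputable instance : Inv Octonion := ⟨fun x => (normSq x)⁻¹ • star x⟩

@[simp] theorem star_fst (x : Octonion) : (star x).fst = star x.fst := rfl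
@[simp] theorem star_snd (x : Octonion) : (star x).snd = -x.snd := rfl

theorem mul_star_self (x : Octonion) : x * star x = normSq x • (1 : Octonion) := by
  ext <;> simp [normSq, Quaternion.normSq_def'] <;> ring

theorem normSq_eq_zero {x : Octonion} : normSq x = 0 ↔ x = 0 := by
  have h1 := Quaternion.normSq_nonneg (a := x.fst)
  have h2 := Quaternion.normSq_nonneg (a := x.snd)
  constructor
  · intro h
    unfold normSq at h
    ext1
    · exact Quaternion.normSq_eq_zero.mp (by linarith)
    · exact Quaternion.normSq_eq_zero.mp (by linarith)
  · rintro rfl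
    simp [normSq]

/-- `x⁻¹` is indeed an inverse of `x ≠ 0`. -/
theorem mul_inv_self {x : Octonion} (hx : x ≠ 0) : x * x⁻¹ = 1 := by
  have h : normSq x ≠ 0 := fun h => hx (normSq_eq_zero.mp h)
  have h2 : x * x⁻¹ = (normSq x)⁻¹ • (x * star x) := by
    change x * ((normSq x)⁻¹ • star x) = _
    ext1 <;> simp [smul_add]
  rw [h2, mul_star_self, smul_smul, inv_mul_cancel₀ h, one_smul]

/-- `α` and `β` are conjugate: `β = x α x⁻¹` for some octonion `x ≠ 0` (the bracketing is immaterial,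
since the subalgebra generated by `α` and `x` is associative and contains `x⁻¹`). -/
def IsConjugate (α β : Octonion) : Prop :=
  ∃ x : Octonion, x ≠ 0 ∧ β = (x * α) * x⁻¹

theorem isConjugate_of_mul_eq {x α β : Octonion} (hx : x ≠ 0) (h : x * α = β * x) :
    IsConjugate α β := by
  refine ⟨x, hx, ?_⟩
  have h0 : normSq x ≠ 0 := fun h => hx (normSq_eq_zero.mp h)
  have h1 : (β * x) * x⁻¹ = (normSq x)⁻¹ • ((β * x) * star x) := by
    change (β * x) * ((normSq x)⁻¹ • star x) = _
    ext1 <;> simp [smul_add]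
  have h2 : (β * x) * star x = normSq x • β := by
    ext <;> simp [normSq, Quaternion.normSq_def'] <;> ring
  rw [h, h1, h2, smul_smul, inv_mul_cancel₀ h0, one_smul]

/-- Conjugacy classes are the sets of octonions with a given real part and a given norm, that is, the
sets `{Re α + |Im α| I : I ^ 2 = -1}`. -/
theorem isConjugate_iff {α β : Octonion} :
    IsConjugate α β ↔ β.fst.re = α.fst.re ∧ normSq β = normSq α := by
  constructor
  · rintro ⟨x, hx, rfl⟩
    have h : normSq x ≠ 0 := fun h => hx (normSq_eq_zero.mp h)
    have h0 : (x * α) * x⁻¹ = (normSq x)⁻¹ • ((x * α) * star x) := by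
      change (x * α) * ((normSq x)⁻¹ • star x) = _
      ext1 <;> simp [smul_add]
    have hm : ∀ y z : Octonion, normSq (y * z) = normSq y * normSq z := by
      intro y z
      simp [normSq, Quaternion.normSq_def']
      ring
    constructor
    · rw [h0, smul_fst, Quaternion.re_smul, smul_eq_mul, inv_mul_eq_iff_eq_mul₀ h]
      simp [normSq, Quaternion.normSq_def']
      ring
    · have h1 : normSq x * normSq x⁻¹ = 1 := by
        rw [← hm, mul_inv_self hx]
        simp [normSq]
      rw [hm, hm]
      linear_combination normSq α * h1
  · rintro ⟨hr, hn⟩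
    by_cases hx : β - star α = 0
    · obtain rfl : β = star α := sub_eq_zero.mp hx
      obtain ⟨x, hx, h0, h1, h2, h3⟩ : ∃ x : Octonion, x ≠ 0 ∧ x.fst.re = 0 ∧
          x.fst.imK = 0 ∧ x.snd = 0 ∧
          x.fst.imI * α.fst.imI + x.fst.imJ * α.fst.imJ = 0 := by
        by_cases h : α.fst.imI = 0 ∧ α.fst.imJ = 0
        · refine ⟨⟨⟨0, 1, 0, 0⟩, 0⟩, fun h' => ?_, rfl, rfl, rfl, by simp [h.1, h.2]⟩
          simpa using congrArg (fun y : Octonion => y.fst.imI) h'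
        · refine ⟨⟨⟨0, α.fst.imJ, -α.fst.imI, 0⟩, 0⟩, fun h' => h ?_, rfl, rfl, rfl, ?_⟩
          · have h1 := congrArg (fun y : Octonion => y.fst.imI) h'
            have h2 := congrArg (fun y : Octonion => y.fst.imJ) h'
            exact ⟨by simpa using h2, by simpa using h1⟩
          · simp only
            ring
      refine isConjugate_of_mul_eq hx ?_
      ext <;> simp [h0, h1, h2] <;> linarith
    · refine isConjugate_of_mul_eq hx ?_
      have q : β * β = (2 * β.fst.re) • β - normSq β • 1 := by
        ext <;> simp [normSq, Quaternion.normSq_def'] <;> ring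
      have q1 : star α * α = normSq α • (1 : Octonion) := by
        ext <;> simp [normSq, Quaternion.normSq_def'] <;> ring
      have q2 : star α = (2 * α.fst.re) • (1 : Octonion) - α := by
        ext <;> simp <;> ring
      have q3 : β * ((2 * β.fst.re) • (1 : Octonion)) = (2 * β.fst.re) • β := by
        ext <;> simp
      rw [sub_mul, mul_sub, q1, q, hn, q2, ← hr, mul_sub, q3]
      abel

end Octonion

/-- Octonionic polynomials `∑ i, w ^ i * a i` with the coefficients written on the right; the `i`-th
value of the finitely supported function is the coefficient `a i`. -/
abbrev OctPoly := ℕ →₀ Octonion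

namespace OctPoly

/-- The value `∑ i, x ^ i * a i` of a polynomial at the octonion `x`. -/
noncomputable def eval (x : Octonion) (f : OctPoly) : Octonion :=
  f.sum fun i a => x ^ i * a

/-- `f` has degree `n`: the coefficient of `w ^ n` is nonzero and all later ones vanish. -/
def HasDegree (f : OctPoly) (n : ℕ) : Prop :=
  f n ≠ 0 ∧ ∀ m, n < m → f m = 0

/-- The constant polynomial `c`. -/
noncomputable def const (c : Octonion) : OctPoly := Finsupp.single 0 c

/-- The polynomial `w - α`. -/
noncomputable def linear (α : Octonion) : OctPoly := Finsupp.single 1 1 - const α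

/-- The product `f ∗ g`, in which `w` is a commuting variable: the coefficient of `w ^ k` is
`∑ i + j = k, a i * b j`. -/
noncomputable def starMul (f g : OctPoly) : OctPoly :=
  f.sum fun i a => g.sum fun j b => Finsupp.single (i + j) (a * b)

theorem starMul_apply (f g : OctPoly) (k : ℕ) :
    starMul f g k = ∑ p ∈ Finset.HasAntidiagonal.antidiagonal k, f p.1 * g p.2 := by
  classical
  induction f using Finsupp.induction_linear with
  | zero => simp [starMul]
  | add f₁ f₂ h₁ h₂ =>
    have : starMul (f₁ + f₂) g = starMul f₁ g + starMul f₂ g := by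
      unfold starMul
      refine Finsupp.sum_add_index' (by simp) fun i a b => ?_
      simp [add_mul, Finsupp.sum_add]
    simp [this, h₁, h₂, add_mul, Finset.sum_add_distrib]
  | single i a =>
    have h : starMul (Finsupp.single i a) g
        = g.sum fun j b => Finsupp.single (i + j) (a * b) := Finsupp.sum_single_index (by simp)
    rw [h]
    induction g using Finsupp.induction_linear with
    | zero => simp
    | add g₁ g₂ h₁ h₂ =>
      rw [Finsupp.sum_add_index' (by simp) (by simp [mul_add])]
      simp only [Finsupp.add_apply, h₁ (Finsupp.sum_single_index (by simp)),
        h₂ (Finsupp.sum_single_index (by simp)), mul_add, Finset.sum_add_distrib]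
    | single j b =>
      rw [Finsupp.sum_single_index (by simp), Finsupp.single_apply]
      split_ifs with hk
      · subst hk
        rw [Finset.sum_eq_single (i, j)]
        · simp
        · rintro ⟨p, q⟩ hp hne
          simp only [Finset.HasAntidiagonal.mem_antidiagonal] at hp
          by_cases hi : i = p
          · subst hi
            have hq : q = j := by omega
            exact absurd (by rw [hq]) hne
          · simp [Finsupp.single_apply, hi]
        · intro h; simp at h
      · symm
        refine Finset.sum_eq_zero fun p hp => ?_
        simp only [Finset.HasAntidiagonal.mem_antidiagonal] at hp
        by_cases hi : i = p.1
        · have : j ≠ p.2 := by rintro rfl; exact hk (by rw [hi, hp])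
          simp [Finsupp.single_apply, this]
        · simp [Finsupp.single_apply, hi]

end OctPoly

/-! ### Octonion identities, imaginary units and complex slices. -/

namespace Octonion

/-! Every octonion is `a + bI` with `I` an imaginary unit. Put `z = a + bi`; then `f(a + bI) = u + I
v`, where `u`, `v` depend on `f` and `z` but not on `I` (`eval_eq_slice`). So `f` has a zero on the
sphere of all `a + bJ`, a set of mutually conjugate octonions, exactly when some unit `J` gives `u =
-J v`; for this it suffices that `u` and `v` are orthogonal of equal norm.

Two facts follow. Multiplying by `w - α` on the left turns a pair `(-I v, v)` into `(γ(-I v), γ v)`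
with `γ = a - bI - α`; left multiplication by `γ` scales norms and inner products by the same
factor, so the sphere of a zero of `g` still contains a zero of `(w - α) ∗ g`. And the complex
polynomial `companion f` takes the value `|u|² - |v|² + 2i⟨u, v⟩` at `z`, so each of its complex
roots yields a zero of `f`.

Dividing by `w - α₁` at a zero, choosing a zero of the quotient and inducting on the degree gives
the factorization; conjugacy is carried back one factor at a time. -/

theorem npow_zero (x : Octonion) : x ^ 0 = 1 := rfl

theorem npow_succ (x : Octonion) (n : ℕ) : x ^ (n + 1) = x ^ n * x := rfl

theorem smul_mul_left (r : ℝ) (x y : Octonion) : (r • x) * y = r • (x * y) := by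
  ext1 <;> simp [smul_sub]

theorem mul_smul_right (r : ℝ) (x y : Octonion) : x * (r • y) = r • (x * y) := by
  ext1 <;> simp [smul_sub]

theorem normSq_mul (x y : Octonion) : normSq (x * y) = normSq x * normSq y := by
  simp [normSq, Quaternion.normSq_def']
  ring

theorem normSq_smul (r : ℝ) (x : Octonion) : normSq (r • x) = r ^ 2 * normSq x := by
  simp [normSq, Quaternion.normSq_def']
  ring

theorem normSq_neg (x : Octonion) : normSq (-x) = normSq x := by
  simp [normSq, Quaternion.normSq_def']

theorem normSq_star (x : Octonion) : normSq (star x) = normSq x := by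
  simp [normSq, Quaternion.normSq_def']

theorem mul_self_mul (x y : Octonion) : x * (x * y) = (x * x) * y := by
  ext <;> simp <;> ring

theorem mul_star_mul_self (x y : Octonion) : (x * star y) * y = normSq y • x := by
  ext <;> simp [normSq, Quaternion.normSq_def'] <;> ring

/-- The Euclidean inner product is multiplicative in a common left factor. -/
theorem re_mul_star_mul_left (c x y : Octonion) :
    ((c * x) * star (c * y)).fst.re = normSq c * (x * star y).fst.re := by
  simp [normSq, Quaternion.normSq_def']
  ring

/-- The imaginary units of the octonions. -/
structure IsImUnit (I : Octonion) : Prop where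
  re_eq : I.fst.re = 0
  normSq_eq : normSq I = 1

theorem IsImUnit.mul_self {I : Octonion} (hI : IsImUnit I) : I * I = -1 := by
  have q : I * I = (2 * I.fst.re) • I - normSq I • 1 := by
    ext <;> simp [normSq, Quaternion.normSq_def'] <;> ring
  rw [q, hI.re_eq, hI.normSq_eq]
  simp

theorem exists_isImUnit : ∃ I : Octonion, IsImUnit I :=
  ⟨⟨⟨0, 1, 0, 0⟩, 0⟩, rfl, by
    rw [normSq, Quaternion.normSq_def', Quaternion.normSq_def']
    norm_num⟩

/-- Every octonion lies in a complex slice. -/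
theorem exists_eq_add_smul_isImUnit (x : Octonion) :
    ∃ (z : ℂ) (I : Octonion), IsImUnit I ∧ x = z.re • (1 : Octonion) + z.im • I := by
  set y : Octonion := x - x.fst.re • (1 : Octonion) with hy
  have hyre : y.fst.re = 0 := by simp [hy]
  have hx : x = x.fst.re • (1 : Octonion) + y := by simp [hy]
  by_cases h : y = 0
  · obtain ⟨I, hI⟩ := exists_isImUnit
    refine ⟨⟨x.fst.re, 0⟩, I, hI, ?_⟩
    rw [h] at hx
    simpa using hx
  · have hn : normSq y ≠ 0 := fun h' => h (normSq_eq_zero.mp h')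
    have h0 : 0 ≤ normSq y :=
      add_nonneg Quaternion.normSq_nonneg Quaternion.normSq_nonneg
    have hs : √(normSq y) ≠ 0 := fun h' => hn ((Real.sqrt_eq_zero h0).mp h')
    refine ⟨⟨x.fst.re, √(normSq y)⟩, (√(normSq y))⁻¹ • y, ⟨by simp [hyre], ?_⟩, ?_⟩
    · rw [normSq_smul, inv_pow, Real.sq_sqrt h0, inv_mul_cancel₀ hn]
    · rw [smul_smul, mul_inv_cancel₀ hs, one_smul]
      exact hx

theorem IsImUnit.npow {I : Octonion} (hI : IsImUnit I) (z : ℂ) (n : ℕ) :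
    (z.re • (1 : Octonion) + z.im • I) ^ n = (z ^ n).re • (1 : Octonion) + (z ^ n).im • I := by
  induction n with
  | zero => simp [npow_zero]
  | succ n ih =>
    rw [npow_succ, ih, pow_succ]
    simp only [mul_add, add_mul, smul_mul_left, mul_smul_right, hI.mul_self, Complex.mul_re,
      Complex.mul_im, one_mul, mul_one]
    module

theorem IsImUnit.isConjugate {I J : Octonion} (hI : IsImUnit I) (hJ : IsImUnit J) (z : ℂ) :
    IsConjugate (z.re • (1 : Octonion) + z.im • I) (z.re • (1 : Octonion) + z.im • J) := by
  have key : ∀ {K : Octonion}, IsImUnit K →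
      normSq (z.re • (1 : Octonion) + z.im • K) = z.re ^ 2 + z.im ^ 2 := by
    intro K hK
    have e : normSq (z.re • (1 : Octonion) + z.im • K)
        = z.re ^ 2 + 2 * z.re * z.im * K.fst.re + z.im ^ 2 * normSq K := by
      simp [normSq, Quaternion.normSq_def']
      ring
    rw [e, hK.re_eq, hK.normSq_eq]
    ring
  rw [isConjugate_iff, key hI, key hJ]
  simp [hI.re_eq, hJ.re_eq]

theorem IsConjugate.trans {a b c : Octonion} (h : IsConjugate a b) (h' : IsConjugate b c) :
    IsConjugate a c := by
  rw [isConjugate_iff] at *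
  exact ⟨h'.1.trans h.1, h'.2.trans h.2⟩

/-- For `v ≠ 0` the equation forces `J = -u v⁻¹`; equal norms make it a unit, orthogonality makes it
imaginary. -/
theorem exists_isImUnit_add_mul_eq_zero {u v : Octonion} (hn : normSq u = normSq v)
    (ho : (u * star v).fst.re = 0) : ∃ J : Octonion, IsImUnit J ∧ u + J * v = 0 := by
  by_cases hv : v = 0
  · obtain ⟨J, hJ⟩ := exists_isImUnit
    have hu : u = 0 := by
      rw [← normSq_eq_zero, hn, hv, normSq_eq_zero]
    exact ⟨J, hJ, by simp [hu, hv]⟩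
  · have h : normSq v ≠ 0 := fun h' => hv (normSq_eq_zero.mp h')
    refine ⟨-((normSq v)⁻¹ • (u * star v)), ⟨?_, ?_⟩, ?_⟩
    · rw [neg_fst, smul_fst, Quaternion.re_neg, Quaternion.re_smul, ho]
      simp
    · rw [normSq_neg, normSq_smul, normSq_mul, normSq_star, hn]
      field_simp
    · rw [neg_mul, smul_mul_left, mul_star_mul_self, smul_smul, inv_mul_cancel₀ h, one_smul,
        add_neg_cancel]

/-- Power form of the left alternative law. -/
theorem npow_mul_mul (x y : Octonion) (n : ℕ) : x ^ n * (x * y) = (x ^ n * x) * y := by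
  obtain ⟨z, I, hI, rfl⟩ := exists_eq_add_smul_isImUnit x
  rw [hI.npow]
  simp only [mul_add, add_mul, smul_mul_left, mul_smul_right, hI.mul_self, mul_self_mul,
    one_mul, mul_one, neg_mul, smul_neg]

end Octonion

/-! ### Evaluation on slices. -/

namespace OctPoly

open Octonion

theorem eval_add (x : Octonion) (f g : OctPoly) : eval x (f + g) = eval x f + eval x g :=
  Finsupp.sum_add_index' (by simp) (by simp [mul_add])

theorem eval_single (x : Octonion) (i : ℕ) (a : Octonion) :
    eval x (Finsupp.single i a) = x ^ i * a :=
  Finsupp.sum_single_index (by simp)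

theorem eval_zero (x : Octonion) : eval x 0 = 0 := Finsupp.sum_zero_index

theorem eval_const (x c : Octonion) : eval x (const c) = c := by
  rw [const, eval_single, npow_zero, one_mul]

/-- The combination `∑ i, c i • a i` of the coefficients with real weights. -/
noncomputable def weightedSum (c : ℕ → ℝ) (f : OctPoly) : Octonion :=
  f.sum fun i a => c i • a

theorem weightedSum_add (c : ℕ → ℝ) (f g : OctPoly) :
    weightedSum c (f + g) = weightedSum c f + weightedSum c g :=
  Finsupp.sum_add_index' (by simp) (by simp)

theorem weightedSum_single (c : ℕ → ℝ) (i : ℕ) (a : Octonion) :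
    weightedSum c (Finsupp.single i a) = c i • a :=
  Finsupp.sum_single_index (by simp)

theorem weightedSum_zero (c : ℕ → ℝ) : weightedSum c 0 = 0 := Finsupp.sum_zero_index

/-- The real part of the value at `z` of the polynomial over the complexified octonions. -/
noncomputable abbrev sliceRe (z : ℂ) (f : OctPoly) : Octonion :=
  weightedSum (fun i => (z ^ i).re) f

/-- The imaginary part of the value at `z` of the polynomial over the complexified octonions. -/
noncomputable abbrev sliceIm (z : ℂ) (f : OctPoly) : Octonion :=
  weightedSum (fun i => (z ^ i).im) f

theorem eval_eq_slice {I : Octonion} (hI : IsImUnit I) (z : ℂ) (f : OctPoly) :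
    eval (z.re • (1 : Octonion) + z.im • I) f = sliceRe z f + I * sliceIm z f := by
  induction f using Finsupp.induction_linear with
  | zero => simp [eval_zero, weightedSum_zero]
  | add f g hf hg =>
    simp only [eval_add, hf, hg, sliceRe, sliceIm, weightedSum_add, mul_add]
    abel
  | single i a =>
    simp only [eval_single, sliceRe, sliceIm, weightedSum_single, hI.npow, add_mul,
      smul_mul_left, mul_smul_right, one_mul]

/-! ### Left division by a linear factor. -/

theorem starMul_add (f g h : OctPoly) : starMul f (g + h) = starMul f g + starMul f h := by
  ext1 k
  simp [starMul_apply, mul_add, Finset.sum_add_distrib]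

theorem starMul_zero (f : OctPoly) : starMul f 0 = 0 := by
  ext1 k
  simp [starMul_apply]

theorem linear_starMul_apply_zero (α : Octonion) (g : OctPoly) :
    starMul (linear α) g 0 = -(α * g 0) := by
  simp [starMul_apply, linear, const]

theorem linear_starMul_apply_succ (α : Octonion) (g : OctPoly) (k : ℕ) :
    starMul (linear α) g (k + 1) = g k - α * g (k + 1) := by
  rw [starMul_apply, Finset.Nat.sum_antidiagonal_succ]
  rw [Finset.sum_eq_single (0, k)]
  · simp [linear, const, sub_eq_neg_add]
  · rintro ⟨i, j⟩ hij hne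
    have hi : i ≠ 0 := by
      rintro rfl
      simp only [Finset.HasAntidiagonal.mem_antidiagonal, zero_add] at hij
      exact hne (by rw [hij])
    simp [linear, const, hi]
  · intro h
    simp at h

theorem linear_starMul_single (α : Octonion) (j : ℕ) (b : Octonion) :
    starMul (linear α) (Finsupp.single j b)
      = Finsupp.single (j + 1) b - Finsupp.single j (α * b) := by
  ext1 k
  cases k with
  | zero =>
    rw [linear_starMul_apply_zero]
    by_cases h : j = 0 <;> simp [h]
  | succ k =>
    rw [linear_starMul_apply_succ]
    by_cases h : j = k + 1 <;> simp [Finsupp.single_apply, h]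

/-- Evaluation is not multiplicative, but on monomials this is `(α ^ j * α) * b = α ^ j * (α * b)`,
which `npow_mul_mul` supplies. -/
theorem eval_linear_starMul_self (α : Octonion) (g : OctPoly) :
    eval α (starMul (linear α) g) = 0 := by
  induction g using Finsupp.induction_linear with
  | zero => rw [starMul_zero, eval_zero]
  | add g h hg hh => rw [starMul_add, eval_add, hg, hh, add_zero]
  | single j b =>
    rw [linear_starMul_single, sub_eq_add_neg, ← Finsupp.single_neg, eval_add, eval_single,
      eval_single, npow_succ, mul_neg, npow_mul_mul, add_neg_cancel]

/-- Left division by `w - α` with remainder. -/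
theorem exists_eq_linear_starMul_add_const (α : Octonion) (f : OctPoly) :
    ∃ (g : OctPoly) (r : Octonion), f = starMul (linear α) g + const r := by
  induction f using Finsupp.induction_linear with
  | zero => exact ⟨0, 0, by simp [starMul_zero, const]⟩
  | add f₁ f₂ h₁ h₂ =>
    obtain ⟨g₁, r₁, h₁⟩ := h₁
    obtain ⟨g₂, r₂, h₂⟩ := h₂
    refine ⟨g₁ + g₂, r₁ + r₂, ?_⟩
    rw [h₁, h₂, starMul_add, const, const, const, Finsupp.single_add]
    abel
  | single j b =>
    induction j generalizing b with
    | zero => exact ⟨0, b, by simp [starMul_zero, const]⟩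
    | succ j ih =>
      obtain ⟨g, r, h⟩ := ih (α * b)
      refine ⟨Finsupp.single j b + g, r, ?_⟩
      rw [starMul_add, add_assoc, ← h, linear_starMul_single, sub_add_cancel]

theorem exists_eq_linear_starMul {α : Octonion} {f : OctPoly} (h : eval α f = 0) :
    ∃ g : OctPoly, f = starMul (linear α) g := by
  obtain ⟨g, r, hf⟩ := exists_eq_linear_starMul_add_const α f
  have hr : r = 0 := by
    rw [hf, eval_add, eval_linear_starMul_self, eval_const, zero_add] at h
    exact h
  exact ⟨g, by rw [hf, hr]; simp [const]⟩

theorem HasDegree.of_linear_starMul {α : Octonion} {g : OctPoly} {n : ℕ}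
    (h : HasDegree (starMul (linear α) g) (n + 1)) : HasDegree g n := by
  have hz : ∀ m, n < m → g m = 0 := by
    -- Above `n` the product has `g m - α * g (m + 1) = 0`, so vanishing propagates downwards from
    -- beyond the support.
    have step : ∀ d m, n < m → g (m + d) = 0 → g m = 0 := by
      intro d
      induction d with
      | zero => exact fun m _ h => h
      | succ d ih =>
        intro m hm h'
        have h1 : g (m + 1) = 0 :=
          ih (m + 1) (by omega) (by rwa [Nat.add_right_comm, Nat.add_assoc])
        have h2 := h.2 (m + 1) (by omega)
        rw [linear_starMul_apply_succ, h1, mul_zero, sub_zero] at h2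
        exact h2
    intro m hm
    refine step (g.support.sup id + 1) m hm ?_
    by_contra hne
    have := Finset.le_sup (f := id) (Finsupp.mem_support_iff.mpr hne)
    simp only [id] at this
    omega
  refine ⟨fun h0 => h.1 ?_, hz⟩
  rw [linear_starMul_apply_succ, h0, hz (n + 1) (by omega), mul_zero, sub_zero]

theorem HasDegree.eq_const {g : OctPoly} (h : HasDegree g 0) : g = const (g 0) := by
  ext1 k
  rcases Nat.eq_zero_or_pos k with rfl | hk
  · simp [const]
  · simp [const, h.2 k hk, hk.ne]

/-! ### Transport of zeros through a linear factor. -/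

theorem sliceRe_linear_starMul (z : ℂ) (α : Octonion) (g : OctPoly) :
    sliceRe z (starMul (linear α) g)
      = z.re • sliceRe z g - z.im • sliceIm z g - α * sliceRe z g := by
  induction g using Finsupp.induction_linear with
  | zero => simp [starMul_zero, weightedSum_zero]
  | add g h hg hh =>
    simp only [sliceRe, sliceIm] at *
    simp only [starMul_add, weightedSum_add, hg, hh, smul_add, mul_add]
    abel
  | single j b =>
    simp only [linear_starMul_single, sliceRe, sliceIm, sub_eq_add_neg, ← Finsupp.single_neg,
      weightedSum_add, weightedSum_single, pow_succ, Complex.mul_re, mul_smul_right]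
    module

theorem sliceIm_linear_starMul (z : ℂ) (α : Octonion) (g : OctPoly) :
    sliceIm z (starMul (linear α) g)
      = z.re • sliceIm z g + z.im • sliceRe z g - α * sliceIm z g := by
  induction g using Finsupp.induction_linear with
  | zero => simp [starMul_zero, weightedSum_zero]
  | add g h hg hh =>
    simp only [sliceRe, sliceIm] at *
    simp only [starMul_add, weightedSum_add, hg, hh, smul_add, mul_add]
    abel
  | single j b =>
    simp only [linear_starMul_single, sliceRe, sliceIm, sub_eq_add_neg, ← Finsupp.single_neg,
      weightedSum_add, weightedSum_single, pow_succ, Complex.mul_im, mul_smul_right]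
    module

/-- A zero of `g` is conjugate to a zero of `(w - α) ∗ g`. -/
theorem exists_isConjugate_eval_linear_starMul_eq_zero (α : Octonion) {β : Octonion}
    {g : OctPoly} (h : eval β g = 0) :
    ∃ β' : Octonion, eval β' (starMul (linear α) g) = 0 ∧ IsConjugate β β' := by
  obtain ⟨z, I, hI, rfl⟩ := exists_eq_add_smul_isImUnit β
  rw [eval_eq_slice hI] at h
  set v := sliceIm z g with hv
  -- The conjugate slice point appears because moving `I` past `I * v` uses only `I * (I * v) = -v`,
  -- with no reassociation across `α`.
  set γ : Octonion := z.re • (1 : Octonion) - z.im • I - α with hγ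
  have hu : sliceRe z g = -(I * v) := eq_neg_of_add_eq_zero_left h
  have hIv : I * (I * v) = -v := by rw [mul_self_mul, hI.mul_self, neg_mul, one_mul]
  have hre : sliceRe z (starMul (linear α) g) = γ * -(I * v) := by
    rw [sliceRe_linear_starMul, hu, hγ, ← hv]
    simp only [sub_mul, smul_mul_left, one_mul, mul_neg, hIv]
    module
  have him : sliceIm z (starMul (linear α) g) = γ * v := by
    rw [sliceIm_linear_starMul, hu, hγ, ← hv]
    simp only [sub_mul, smul_mul_left, one_mul]
    module
  have hvv : ((-(I * v)) * star v).fst.re = -(normSq v * I.fst.re) := by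
    simp [normSq, Quaternion.normSq_def']
    ring
  obtain ⟨J, hJ, hJ0⟩ := exists_isImUnit_add_mul_eq_zero
    (u := sliceRe z (starMul (linear α) g)) (v := sliceIm z (starMul (linear α) g))
    (by rw [hre, him, normSq_mul, normSq_mul, normSq_neg, normSq_mul, hI.normSq_eq, one_mul])
    (by rw [hre, him, re_mul_star_mul_left, hvv, hI.re_eq]; simp)
  exact ⟨_, by rw [eval_eq_slice hJ, hJ0], hI.isConjugate hJ z⟩

/-! ### Companion polynomial and existence of zeros. -/

/-- The complex polynomial whose coefficients are the values of a real functional at the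
coefficients of `f`. -/
noncomputable def coordPoly (l : Octonion →+ ℝ) (f : OctPoly) : Polynomial ℂ :=
  f.sum fun i a => Polynomial.monomial i ((l a : ℝ) : ℂ)

theorem coordPoly_coeff (l : Octonion →+ ℝ) (f : OctPoly) (k : ℕ) :
    (coordPoly l f).coeff k = (l (f k) : ℂ) := by
  rw [coordPoly, Finsupp.sum, Polynomial.finsetSum_coeff]
  simp only [Polynomial.coeff_monomial]
  rw [Finset.sum_ite_eq']
  split_ifs with h
  · rfl
  · simp [Finsupp.notMem_support_iff.mp h]

theorem coordPoly_eval (l : Octonion →+ ℝ) (hl : ∀ (r : ℝ) x, l (r • x) = r * l x)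
    (f : OctPoly) (z : ℂ) :
    (coordPoly l f).eval z = ⟨l (sliceRe z f), l (sliceIm z f)⟩ := by
  simp only [coordPoly, sliceRe, sliceIm, weightedSum, Finsupp.sum, Polynomial.eval_finsetSum,
    map_sum, Polynomial.eval_monomial, hl]
  apply Complex.ext <;> simp [mul_comm]

/-- The eight real coordinates. -/
noncomputable def coord : Fin 8 → Octonion →+ ℝ :=
  ![.mk' (fun x => x.fst.re) fun _ _ => rfl, .mk' (fun x => x.fst.imI) fun _ _ => rfl,
    .mk' (fun x => x.fst.imJ) fun _ _ => rfl, .mk' (fun x => x.fst.imK) fun _ _ => rfl,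
    .mk' (fun x => x.snd.re) fun _ _ => rfl, .mk' (fun x => x.snd.imI) fun _ _ => rfl,
    .mk' (fun x => x.snd.imJ) fun _ _ => rfl, .mk' (fun x => x.snd.imK) fun _ _ => rfl]

theorem coord_smul (c : Fin 8) (r : ℝ) (x : Octonion) : coord c (r • x) = r * coord c x := by
  fin_cases c <;> rfl

theorem sum_coord_sq (x : Octonion) : ∑ c, coord c x ^ 2 = normSq x := by
  rw [Fin.sum_univ_eight, normSq, Quaternion.normSq_def', Quaternion.normSq_def']
  simp only [← add_assoc]
  rfl

theorem sum_coord_mul (x y : Octonion) :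
    ∑ c, coord c x * coord c y = (x * star y).fst.re := by
  have h : ∑ c, coord c x * coord c y
      = x.fst.re * y.fst.re + x.fst.imI * y.fst.imI + x.fst.imJ * y.fst.imJ
        + x.fst.imK * y.fst.imK + x.snd.re * y.snd.re + x.snd.imI * y.snd.imI
        + x.snd.imJ * y.snd.imJ + x.snd.imK * y.snd.imK := by
    rw [Fin.sum_univ_eight]
    rfl
  rw [h]
  simp
  ring

/-- The companion polynomial `∑ i j, ⟪a i, a j⟫ X ^ (i + j)` of `f`. -/
noncomputable def companion (f : OctPoly) : Polynomial ℂ :=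
  ∑ c, coordPoly (coord c) f ^ 2

theorem companion_eval (f : OctPoly) (z : ℂ) :
    (companion f).eval z = ⟨normSq (sliceRe z f) - normSq (sliceIm z f),
      2 * (sliceRe z f * star (sliceIm z f)).fst.re⟩ := by
  simp only [companion, Polynomial.eval_finsetSum, Polynomial.eval_pow,
    coordPoly_eval _ (coord_smul _), ← sum_coord_sq, ← sum_coord_mul]
  apply Complex.ext
  · simp only [Complex.re_sum, sq, Complex.mul_re, Finset.sum_sub_distrib]
  · simp only [Complex.im_sum, sq, Complex.mul_im, Finset.mul_sum]
    exact Finset.sum_congr rfl fun c _ => by ring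

theorem HasDegree.companion_coeff {f : OctPoly} {n : ℕ} (hf : HasDegree f n) :
    (companion f).coeff (n + n) = (normSq (f n) : ℂ) := by
  have hdeg : ∀ c, (coordPoly (coord c) f).natDegree ≤ n := fun c => by
    rw [Polynomial.natDegree_le_iff_coeff_eq_zero]
    intro m hm
    rw [coordPoly_coeff, hf.2 m hm, map_zero, Complex.ofReal_zero]
  rw [companion, Polynomial.finsetSum_coeff, ← sum_coord_sq, Complex.ofReal_sum]
  refine Finset.sum_congr rfl fun c _ => ?_
  rw [sq, Polynomial.coeff_mul_add_eq_of_natDegree_le (hdeg c) (hdeg c), coordPoly_coeff,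
    Complex.ofReal_pow, sq]

/-- The fundamental theorem of algebra for regular octonionic polynomials. -/
theorem HasDegree.exists_eval_eq_zero {f : OctPoly} {n : ℕ} (hf : HasDegree f n) (hn : 0 < n) :
    ∃ x : Octonion, eval x f = 0 := by
  have hc : (companion f).coeff (n + n) ≠ 0 := by
    rw [hf.companion_coeff]
    exact Complex.ofReal_ne_zero.mpr fun h => hf.1 (normSq_eq_zero.mp h)
  -- Since `n > 0`, the nonzero coefficient at `n + n` rules out a constant.
  have hd : (companion f).degree ≠ 0 := by
    intro h
    rw [Polynomial.eq_C_of_degree_eq_zero h, Polynomial.coeff_C, if_neg (by omega)] at hc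
    exact hc rfl
  obtain ⟨z, hz⟩ := IsAlgClosed.exists_root (companion f) hd
  rw [Polynomial.IsRoot.def, companion_eval] at hz
  have h1 := congrArg Complex.re hz
  have h2 := congrArg Complex.im hz
  simp only [Complex.zero_re, Complex.zero_im] at h1 h2
  obtain ⟨J, hJ, hJ0⟩ := exists_isImUnit_add_mul_eq_zero
    (u := sliceRe z f) (v := sliceIm z f) (by linarith) (by linarith)
  exact ⟨_, by rw [eval_eq_slice hJ, hJ0]⟩

end OctPoly

/-! ### Induction on the degree. -/

theorem corollary4p2 (n : ℕ) (hn : 0 < n) (f : OctPoly) (hf : OctPoly.HasDegree f n)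
    (α₁ : Octonion) (hα₁ : OctPoly.eval α₁ f = 0) :
    ∃ (α : ℕ → Octonion) (F : ℕ → OctPoly) (c : Octonion),
      c ≠ 0 ∧ α 1 = α₁ ∧ F 0 = f ∧
      (∀ k, k + 2 ≤ n → F k = OctPoly.starMul (OctPoly.linear (α (k + 1))) (F (k + 1))) ∧
      F (n - 1) = OctPoly.starMul (OctPoly.linear (α n)) (OctPoly.const c) ∧
      ∀ k, 1 ≤ k → k < n →
        OctPoly.eval (α (k + 1)) (F k) = 0 ∧
        ∃ α' : Octonion, OctPoly.eval α' f = 0 ∧ Octonion.IsConjugate (α (k + 1)) α' := by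
  induction n generalizing f α₁ with
  | zero => exact absurd hn (lt_irrefl 0)
  | succ n ih =>
    obtain ⟨g, rfl⟩ := OctPoly.exists_eq_linear_starMul hα₁
    have hg := hf.of_linear_starMul
    rcases Nat.eq_zero_or_pos n with rfl | hn'
    · refine ⟨fun _ => α₁, fun _ => OctPoly.starMul (OctPoly.linear α₁) g, g 0, hg.1, rfl, rfl,
        fun k hk => by omega, ?_, fun k h1 h2 => by omega⟩
      rw [← hg.eq_const]
    · obtain ⟨α₂, hα₂⟩ := hg.exists_eval_eq_zero hn'
      obtain ⟨α, F, c, hc, h1, h0, hF, hlast, hzero⟩ := ih hn' g hg α₂ hα₂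
      -- Both sequences for `g` shift by one to make room for `α₁` and `f`; the value of `α` at `0`
      -- plays no role.
      refine ⟨fun k => if k = 1 then α₁ else α (k - 1),
        fun k => Nat.casesOn k (OctPoly.starMul (OctPoly.linear α₁) g) F, c, hc, rfl, rfl,
        ?_, ?_, ?_⟩
      · rintro (_ | k) hk
        · simp [h0]
        · simpa using hF k (by omega)
      · obtain ⟨m, rfl⟩ := Nat.exists_eq_succ_of_ne_zero hn'.ne'
        simpa using hlast
      · rintro (_ | k) hk1 hk2
        · omega
        · have key : OctPoly.eval (α (k + 1)) (F k) = 0 ∧ ∃ α' : Octonion,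
              OctPoly.eval α' g = 0 ∧ Octonion.IsConjugate (α (k + 1)) α' := by
            rcases Nat.eq_zero_or_pos k with rfl | hk
            · rw [zero_add, h1, h0]
              exact ⟨hα₂, α₂, hα₂, Octonion.isConjugate_iff.mpr ⟨rfl, rfl⟩⟩
            · exact hzero k hk (by omega)
          obtain ⟨hz, β, hβ, hconj⟩ := key
          obtain ⟨β', hβ', hconj'⟩ :=
            OctPoly.exists_isConjugate_eval_linear_starMul_eq_zero α₁ hβ
          refine ⟨by simpa using hz, β', hβ', ?_⟩
          simpa using hconj.trans hconj'
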